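/- Let $X$ and $Y$ be topological spaces. A map $f:X\to Y$ is a \emph{Baire-one map}, written $f\in B_1(X,Y)$, if there is a sequence $(f_n)_{n\in\omega}$ of continuous maps $f_n:X\to Y$ with $\lim_{n\to\infty}f_n(x)=f(x)$ for every $x\in X$. It is a \emph{homotopic Baire-one map}, written $f\in hB_1(X,Y)$, if such a sequence can be chosen to consist of pairwise homotopic continuous maps. The space $Y$ is \emph{weakly covered} by a topological space $Z$ if there is a continuous map $\varphi:Z\to Y$ such that every $y\in Y$ has an open neighborhood $V\subseteq Y$ for which there is an open set $U\subseteq Z$ such that $\varphi|_U$ is a homeomorphism of $U$ onto $V$. Let $X$ be a topological space, and let $Y$ be a paracompact Hausdorff space that is weakly covered by a metrizable, contractible, locally path-connected space $Z$. Then $$B_1(X,Y)=hB_1(X,Y).$$ Moreover, every $f\in B_1(X,Y)$ is the pointwise limit of a sequence of null-homotopic continuous maps $X\to Y$ (a map is null-homotopic if it is homotopic to a constant map). -/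

import Mathlib

open Filter Topology

/-- `B₁(X, Y)`: the pointwise limits of sequences of continuous maps `X → Y`. -/
def baireOne (X Y : Type*) [TopologicalSpace X] [TopologicalSpace Y] : Set (X → Y) :=
  {f | ∃ F : ℕ → C(X, Y), ∀ x : X, Tendsto (fun n => F n x) atTop (𝓝 (f x))}

/-- `hB₁(X, Y)`: the pointwise limits of sequences of pairwise homotopic continuous maps
`X → Y`. -/
def homotopicBaireOne (X Y : Type*) [TopologicalSpace X] [TopologicalSpace Y] : Set (X → Y) :=
  {f | ∃ F : ℕ → C(X, Y), (∀ m n : ℕ, (F m).Homotopic (F n)) ∧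
    ∀ x : X, Tendsto (fun n => F n x) atTop (𝓝 (f x))}

/-- A continuous map `φ : Z → Y` is a weak local homeomorphism if every point of `Y` has an open
neighbourhood `V` for which some open `U ⊆ Z` is mapped by `φ` homeomorphically onto `V`. -/
def IsWeakLocalHomeomorph {Z Y : Type*} [TopologicalSpace Z] [TopologicalSpace Y]
    (φ : Z → Y) : Prop :=
  Continuous φ ∧ ∀ y : Y, ∃ (V : Set Y) (U : Set Z), IsOpen V ∧ y ∈ V ∧ IsOpen U ∧
    ∃ e : U ≃ₜ V, ∀ z : U, (e z : Y) = φ z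

/-- The space `Y` is weakly covered by the space `Z`. -/
def IsWeaklyCoveredBy (Y Z : Type*) [TopologicalSpace Y] [TopologicalSpace Z] : Prop :=
  ∃ φ : Z → Y, IsWeakLocalHomeomorph φ

/-! The continuous approximants of `f` need not lift through `φ`, but the limit `f` does, and the
lift is again Baire-one.

Two reductions make everything metrizable. `Y` is paracompact, Hausdorff and locally homeomorphic to
open parts of `Z`, hence metrizable. Any pointwise convergent sequence of maps factors through the
space of convergent sequences in `Y`, so that space can replace `X`.

On a metrizable domain `f` is a uniform limit of piecewise locally constant maps. These allow a
local section of `φ` to be chosen in a piecewise locally constant way, giving `h` with `φ ∘ h = f`;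
local path-connectedness makes `h` a limit of piecewise locally constant maps joined by small paths
(`IsWeakLocalHomeomorph.exists_lift`). Following these paths near the closed pieces gives continuous
maps `g n` tending to `h` (`exists_continuousMap_tendsto_of_joinedIn`). Contractibility of `Z` makes
every `φ ∘ g n` homotopic to one constant. -/

/-- A map is piecewise locally constant if its domain is the union of an increasing sequence of
closed sets on each of which the map is locally constant. -/
def PiecewiseLocallyConstant {X I : Type*} [TopologicalSpace X] (c : X → I) : Prop :=
  ∃ E : ℕ → Set X, Monotone E ∧ (∀ n, IsClosed (E n)) ∧ (∀ x, ∃ n, x ∈ E n) ∧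
    ∀ n, ∀ x ∈ E n, ∀ᶠ y in 𝓝[E n] x, c y = c x

/-! ### Calculus of piecewise locally constant maps -/

namespace PiecewiseLocallyConstant

variable {X Y I J : Type*} [TopologicalSpace X] [TopologicalSpace Y]

theorem map {c : X → I} (hc : PiecewiseLocallyConstant c) (g : I → J) :
    PiecewiseLocallyConstant (fun x => g (c x)) := by
  obtain ⟨E, h1, h2, h3, h4⟩ := hc
  exact ⟨E, h1, h2, h3, fun n x hx => (h4 n x hx).mono fun y hy => congrArg g hy⟩

theorem comp_continuous {c : Y → I} (hc : PiecewiseLocallyConstant c) {f : X → Y}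
    (hf : Continuous f) : PiecewiseLocallyConstant (fun x => c (f x)) := by
  obtain ⟨E, h1, h2, h3, h4⟩ := hc
  refine ⟨fun n => f ⁻¹' E n, fun m n hmn => Set.preimage_mono (h1 hmn),
    fun n => (h2 n).preimage hf, fun x => h3 (f x), fun n x hx => ?_⟩
  have : Tendsto f (𝓝[f ⁻¹' E n] x) (𝓝[E n] (f x)) :=
    hf.continuousWithinAt.tendsto_nhdsWithin (Set.mapsTo_preimage _ _)
  exact this.eventually (h4 n _ hx)

theorem prodMk {c : X → I} {d : X → J} (hc : PiecewiseLocallyConstant c)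
    (hd : PiecewiseLocallyConstant d) : PiecewiseLocallyConstant (fun x => (c x, d x)) := by
  obtain ⟨E, h1, h2, h3, h4⟩ := hc
  obtain ⟨E', h1', h2', h3', h4'⟩ := hd
  refine ⟨fun n => E n ∩ E' n, fun m n hmn => Set.inter_subset_inter (h1 hmn) (h1' hmn),
    fun n => (h2 n).inter (h2' n), fun x => ?_, fun n x hx => ?_⟩
  · obtain ⟨n, hn⟩ := h3 x
    obtain ⟨m, hm⟩ := h3' x
    exact ⟨max n m, h1 (le_max_left _ _) hn, h1' (le_max_right _ _) hm⟩
  · filter_upwards [nhdsWithin_mono x Set.inter_subset_left (h4 n x hx.1),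
      nhdsWithin_mono x Set.inter_subset_right (h4' n x hx.2)] with y hy hy'
    rw [hy, hy']

/-- From a sequence of piecewise locally constant maps one can select, at each point, the first
one with a given property. -/
theorem exists_select {c : ℕ → X → I} (hc : ∀ k, PiecewiseLocallyConstant (c k))
    (Q : ℕ → I → Prop) (hQ : ∀ x, ∃ k, Q k (c k x)) :
    ∃ k : X → ℕ, (∀ x, Q (k x) (c (k x) x)) ∧
      PiecewiseLocallyConstant (fun x => (k x, c (k x) x)) := by
  classical
  choose E h1 h2 h3 h4 using hc
  set k : X → ℕ := fun x => Nat.find (hQ x) with hk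
  have hkQ : ∀ x, Q (k x) (c (k x) x) := fun x => Nat.find_spec (hQ x)
  have hkmin : ∀ x j, Q j (c j x) → k x ≤ j := fun x j hj => Nat.find_min' (hQ x) hj
  refine ⟨k, hkQ, ?_⟩
  have hloc : ∀ m l x, (∀ j ≤ l, x ∈ E j m) →
      ∀ᶠ y in 𝓝 x, ∀ j ≤ l, y ∈ E j m → c j y = c j x := by
    intro m l x hx
    have := (Set.finite_Iic l).eventually_all (l := 𝓝 x)
      (p := fun j y => y ∈ E j m → c j y = c j x)
    exact this.2 fun j hj => eventually_nhdsWithin_iff.1 (h4 j m x (hx j hj))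
  -- Where all of `c 0, …, c l` are locally constant, so are the tests `Q 0, …, Q l`; hence whether
  -- the first success occurs at `l` is locally decided, and each piece is closed.
  refine ⟨fun m => ⋃ l ∈ Set.Iic m, {x | k x = l ∧ ∀ j ≤ l, x ∈ E j m}, ?_, ?_, ?_, ?_⟩
  · intro m n hmn x hx
    simp only [Set.mem_iUnion, Set.mem_Iic, Set.mem_ofPred_eq] at hx ⊢
    obtain ⟨l, hl, hx, hx'⟩ := hx
    exact ⟨l, hl.trans hmn, hx, fun j hj => h1 j hmn (hx' j hj)⟩
  · intro m
    refine (Set.finite_Iic m).isClosed_biUnion fun l _ => ?_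
    refine isClosed_iff_frequently.2 fun x hx => ?_
    have hxE : ∀ j ≤ l, x ∈ E j m := fun j hj =>
      isClosed_iff_frequently.1 (h2 j m) x (hx.mono fun y hy => hy.2 j hj)
    obtain ⟨y, ⟨hy1, hy2⟩, hy3⟩ := (hx.and_eventually (hloc m l x hxE)).exists
    refine ⟨le_antisymm (hkmin x l ?_) ?_, hxE⟩
    · rw [← hy3 l le_rfl (hy2 l le_rfl), ← hy1]
      exact hkQ y
    · by_contra! hlt
      have := hkmin y (k x) (by
        rw [hy3 _ hlt.le (hy2 _ hlt.le)]
        exact hkQ x)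
      omega
  · intro x
    choose N hN using fun j => h3 j x
    refine ⟨max (k x) ((Finset.range (k x + 1)).sup N), ?_⟩
    simp only [Set.mem_iUnion, Set.mem_Iic, Set.mem_ofPred_eq]
    refine ⟨k x, le_max_left _ _, rfl, fun j hj => h1 j ?_ (hN j)⟩
    exact (Finset.le_sup (f := N) (Finset.mem_range.2 (by omega))).trans (le_max_right _ _)
  · intro m x hx
    simp only [Set.mem_iUnion, Set.mem_Iic, Set.mem_ofPred_eq] at hx
    obtain ⟨l, hl, rfl, hxE⟩ := hx
    filter_upwards [self_mem_nhdsWithin, mem_nhdsWithin_of_mem_nhds (hloc m _ x hxE)] with y hy hy'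
    simp only [Set.mem_iUnion, Set.mem_Iic, Set.mem_ofPred_eq] at hy
    obtain ⟨l, hl', rfl, hyE⟩ := hy
    have hxy : k x = k y := by
      rcases lt_or_ge (k y) (k x) with h | h
      · have := hkmin x (k y) (by
          rw [← hy' _ h.le (hyE _ le_rfl)]
          exact hkQ y)
        omega
      · refine le_antisymm h (hkmin y (k x) ?_)
        rw [hy' _ le_rfl (hyE _ h)]
        exact hkQ x
    rw [← hxy, hy' _ le_rfl (hyE _ hxy.le)]

/-- A closed set becomes relatively open once the points outside it but within `1 / (n + 1)` of it
are discarded. -/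
theorem of_isClosed [TopologicalSpace.PseudoMetrizableSpace X] {C : Set X} (hC : IsClosed C) :
    PiecewiseLocallyConstant (fun x => x ∈ C) := by
  let _ := TopologicalSpace.pseudoMetrizableSpacePseudoMetric X
  have hpos : ∀ n : ℕ, (0 : ℝ) < 1 / ((n : ℝ) + 1) := fun n => Nat.one_div_pos_of_nat
  refine ⟨fun n => C ∪ (Metric.thickening (1 / ((n : ℝ) + 1)) C)ᶜ, fun m n hmn => ?_, fun n => ?_,
    fun x => ?_, fun n x hx => ?_⟩
  · exact Set.union_subset_union_right _ (Set.compl_subset_compl.2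
      (Metric.thickening_mono (Nat.one_div_le_one_div hmn) C))
  · exact hC.union Metric.isOpen_thickening.isClosed_compl
  · by_cases hx : x ∈ C
    · exact ⟨0, Or.inl hx⟩
    · rw [← hC.closure_eq, Metric.closure_eq_iInter_thickening] at hx
      simp only [Set.mem_iInter, not_forall] at hx
      obtain ⟨δ, hδ, hx⟩ := hx
      obtain ⟨n, hn⟩ := exists_nat_one_div_lt hδ
      exact ⟨n, Or.inr fun h => hx (Metric.thickening_mono hn.le C h)⟩
  · by_cases hxC : x ∈ C
    · filter_upwards [self_mem_nhdsWithin, mem_nhdsWithin_of_mem_nhds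
        (Metric.isOpen_thickening.mem_nhds (Metric.self_subset_thickening (hpos n) C hxC))]
        with y hy hy'
      simpa [hxC] using hy.resolve_right fun h => h hy'
    · filter_upwards [mem_nhdsWithin_of_mem_nhds (hC.isOpen_compl.mem_nhds hxC)] with y hy
      simp only [hxC]
      simpa using hy

end PiecewiseLocallyConstant

/-! ### Approximation by piecewise locally constant maps -/

/-- Every open cover of a metric space admits a piecewise locally constant choice of members. -/
theorem exists_piecewiseLocallyConstant_mem {Y I : Type*} [PseudoMetricSpace Y] {U : I → Set Y}
    (hU : ∀ i, IsOpen (U i)) (hcov : ∀ y, ∃ i, y ∈ U i) :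
    ∃ c : Y → I, PiecewiseLocallyConstant c ∧ ∀ y, y ∈ U (c y) := by
  classical
  let _ : LinearOrder I := linearOrderOfSTO WellOrderingRel
  have wf : WellFounded ((· < ·) : I → I → Prop) := WellOrderingRel.isWellOrder.wf
  set c : Y → I := fun y => wf.min {i | y ∈ U i} (hcov y) with hcdef
  have hc : ∀ y, y ∈ U (c y) := fun y => wf.min_mem {i | y ∈ U i} (hcov y)
  have hmin : ∀ y i, y ∈ U i → c y ≤ i := fun y i hi => not_lt.1 (wf.not_lt_min _ hi)
  have hpos : ∀ n : ℕ, (0 : ℝ) < 1 / ((n : ℝ) + 1) := fun n => Nat.one_div_pos_of_nat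
  -- Points closer than the common radius lie in each other's chosen set, so minimality of the
  -- indices forces them to agree.
  have hloc : ∀ (n : ℕ) x y, Metric.ball x (1 / ((n : ℝ) + 1)) ⊆ U (c x) →
      Metric.ball y (1 / ((n : ℝ) + 1)) ⊆ U (c y) → dist x y < 1 / ((n : ℝ) + 1) → c x = c y := by
    intro n x y hx hy hxy
    exact le_antisymm (hmin _ _ (hy hxy)) (hmin _ _ (hx (by rwa [Metric.mem_ball, dist_comm])))
  refine ⟨c, ⟨fun n => {x | Metric.ball x (1 / ((n : ℝ) + 1)) ⊆ U (c x)}, fun m n hmn x hx => ?_,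
    fun n => ?_, fun x => ?_, fun n x hx => ?_⟩, hc⟩
  · exact (Metric.ball_subset_ball (Nat.one_div_le_one_div hmn)).trans hx
  · refine isClosed_iff_frequently.2 fun x hx => ?_
    set δ : ℝ := 1 / ((n : ℝ) + 1)
    have hδ : 0 < δ := hpos n
    have hnear : ∀ᶠ y in 𝓝 x, dist y x < δ / 2 := Metric.ball_mem_nhds x (by positivity)
    obtain ⟨y₀, hy₀, hy₀x⟩ := (hx.and_eventually hnear).exists
    have hconst : ∀ y, Metric.ball y δ ⊆ U (c y) → dist y x < δ / 2 → c y = c y₀ := by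
      intro y hy hyx
      refine hloc n y y₀ hy hy₀ ?_
      calc dist y y₀ ≤ dist y x + dist y₀ x := dist_triangle_right _ _ _
        _ < δ := by linarith
    have hball : Metric.ball x δ ⊆ U (c y₀) := by
      intro z hz
      have hz' : 0 < δ - dist z x := sub_pos.2 hz
      have : ∀ᶠ y in 𝓝 x, dist y x < δ - dist z x := Metric.ball_mem_nhds x hz'
      obtain ⟨y, ⟨hy, hyx⟩, hyz⟩ := ((hx.and_eventually hnear).and_eventually this).exists
      rw [← hconst y hy hyx]
      refine hy ?_
      calc dist z y ≤ dist z x + dist y x := dist_triangle_right _ _ _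
        _ < δ := by linarith
    have hcx : c x = c y₀ := by
      refine le_antisymm (hmin _ _ (hball (Metric.mem_ball_self hδ))) ?_
      obtain ⟨y, ⟨hy, hyx⟩, hyU⟩ :=
        ((hx.and_eventually hnear).and_eventually ((hU (c x)).mem_nhds (hc x))).exists
      rw [← hconst y hy hyx]
      exact hmin _ _ hyU
    change Metric.ball x δ ⊆ U (c x)
    rwa [hcx]
  · obtain ⟨δ, hδ, h⟩ := Metric.isOpen_iff.1 (hU (c x)) x (hc x)
    obtain ⟨n, hn⟩ := exists_nat_one_div_lt hδ
    exact ⟨n, (Metric.ball_subset_ball hn.le).trans h⟩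
  · filter_upwards [self_mem_nhdsWithin,
      mem_nhdsWithin_of_mem_nhds (Metric.ball_mem_nhds x (hpos n))] with y hy hyx
    exact hloc n y x hy hx hyx

/-- A pointwise limit of continuous maps into a metric space is a uniform limit of piecewise
locally constant maps. -/
theorem exists_piecewiseLocallyConstant_dist_lt {X Y : Type*} [TopologicalSpace X]
    [TopologicalSpace.PseudoMetrizableSpace X] [PseudoMetricSpace Y] {F : ℕ → C(X, Y)}
    {f : X → Y} (hF : ∀ x, Tendsto (fun n => F n x) atTop (𝓝 (f x))) {ε : ℝ} (hε : 0 < ε) :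
    ∃ a : X → Y, PiecewiseLocallyConstant a ∧ ∀ x, dist (f x) (a x) < ε := by
  obtain ⟨b, hb, hbd⟩ := exists_piecewiseLocallyConstant_mem
    (U := fun y : Y => Metric.ball y (ε / 3)) (fun _ => Metric.isOpen_ball)
    (fun y => ⟨y, Metric.mem_ball_self (by positivity)⟩)
  let C : ℕ → Set X := fun n => {x | ∀ m ≥ n, dist (F m x) (F n x) ≤ ε / 3}
  have hC : ∀ n, IsClosed (C n) := fun n => by
    have : C n = ⋂ m, ⋂ (_ : m ≥ n), {x | dist (F m x) (F n x) ≤ ε / 3} := by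
      ext x; simp [C]
    rw [this]
    exact isClosed_iInter fun m => isClosed_iInter fun _ =>
      isClosed_le (by fun_prop) continuous_const
  -- Membership in `C n` is carried along with the value, so that the first `n` with `x ∈ C n` can
  -- be selected.
  obtain ⟨k, hk, hkc⟩ := PiecewiseLocallyConstant.exists_select
    (c := fun n x => (b (F n x), x ∈ C n))
    (fun n => (hb.comp_continuous (F n).continuous).prodMk (.of_isClosed (hC n)))
    (fun _ i => i.2) (fun x => by
      obtain ⟨n, hn⟩ := Metric.cauchySeq_iff'.1 (hF x).cauchySeq (ε / 3) (by positivity)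
      exact ⟨n, fun m hm => (hn m hm).le⟩)
  refine ⟨_, hkc.map fun i => i.2.1, fun x => ?_⟩
  have h1 : dist (f x) (F (k x) x) ≤ ε / 3 :=
    le_of_tendsto ((hF x).dist tendsto_const_nhds) (eventually_atTop.2 ⟨k x, hk x⟩)
  have h2 : dist (F (k x) x) (b (F (k x) x)) < ε / 3 := hbd _
  calc dist (f x) (b (F (k x) x)) ≤ _ := dist_triangle _ (F (k x) x) _
    _ < ε := by linarith

/-! ### From piecewise locally constant to continuous maps -/

/-- Near a closed set on which it is locally constant, a continuous map can be moved along paths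
to another locally constant map. -/
theorem exists_continuousMap_eventually_eq {X Z : Type*} [PseudoMetricSpace X]
    [TopologicalSpace Z] (G : C(X, Z)) {K : Set X} (hK : IsClosed K)
    (hG : ∀ a ∈ K, ∀ᶠ b in 𝓝 a, G b = G a) {q : X → Z}
    (hq : ∀ a ∈ K, ∀ᶠ b in 𝓝[K] a, q b = q a) (S : Z → Set Z)
    (hS : ∀ a ∈ K, JoinedIn (S (G a)) (G a) (q a)) :
    ∃ G' : C(X, Z), (∀ a ∈ K, ∀ᶠ b in 𝓝 a, G' b = q a) ∧ ∀ x, G' x = G x ∨ G' x ∈ S (G x) := by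
  classical
  have hr : ∀ a ∈ K, ∃ r > 0, ∀ b ∈ Metric.ball a r, G b = G a ∧ (b ∈ K → q b = q a) :=
    fun a ha => Metric.eventually_nhds_iff_ball.1
      ((hG a ha).and (eventually_nhdsWithin_iff.1 (hq a ha)))
  choose! r hr0 hr using hr
  set O : Set X := ⋃ a ∈ K, Metric.ball a (r a / 2) with hOdef
  have hO : IsOpen O := isOpen_biUnion fun _ _ => Metric.isOpen_ball
  have hKO : K ⊆ O := fun a ha =>
    Set.mem_biUnion ha (Metric.mem_ball_self (half_pos (hr0 a ha)))
  have hA : ∀ x ∈ O, ∃ a ∈ K, x ∈ Metric.ball a (r a / 2) := fun x hx => by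
    simpa [hOdef] using hx
  choose! A hAK hA using hA
  have hqA : ∀ a ∈ K, ∀ x ∈ Metric.ball a (r a / 2), q (A x) = q a := by
    intro a ha x hx
    have hxO : x ∈ O := Set.mem_biUnion ha hx
    have h1 : dist x (A x) < r (A x) / 2 := hA x hxO
    have h2 : dist x a < r a / 2 := hx
    have h3 := dist_triangle_left (A x) a x
    rcases le_total (r a) (r (A x)) with h | h
    · refine ((hr _ (hAK x hxO) a ?_).2 ha).symm
      rw [Metric.mem_ball, dist_comm]
      linarith
    · refine (hr _ ha (A x) ?_).2 (hAK x hxO)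
      rw [Metric.mem_ball]
      linarith
  have hGA : ∀ a ∈ K, ∀ x ∈ Metric.ball a (r a / 2), G x = G a := fun a ha x hx =>
    (hr a ha x (Metric.ball_subset_ball (by linarith [hr0 a ha]) hx)).1
  -- The path depends only on its endpoints, so where these are locally constant the same path is
  -- used at all nearby points.
  have hP : ∀ u v : Z, ∃ p : ℝ → Z, Continuous p ∧ (JoinedIn (S u) u v →
      (∀ t ≤ 0, p t = u) ∧ (∀ t, 1 ≤ t → p t = v) ∧ ∀ t, p t ∈ S u) := by
    intro u v
    by_cases h : JoinedIn (S u) u v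
    · refine ⟨h.somePath.extend, h.somePath.continuous_extend, fun _ => ⟨fun t ht => ?_,
        fun t ht => ?_, fun t => ?_⟩⟩
      · exact h.somePath.extend_of_le_zero ht
      · exact h.somePath.extend_of_one_le ht
      · obtain ⟨s, hs⟩ : h.somePath.extend t ∈ Set.range h.somePath := by
          rw [← h.somePath.extend_range]
          exact Set.mem_range_self t
        rw [← hs]
        exact h.somePath_mem s
    · exact ⟨fun _ => u, continuous_const, fun h' => absurd h' h⟩
  choose P hPc hP using hP
  obtain ⟨l, hl0, hl1, -⟩ := exists_continuous_zero_one_of_isClosed hO.isClosed_compl hK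
    (Set.disjoint_left.2 fun x hx hx' => hx (hKO hx'))
  have hjoin : ∀ x ∈ O, JoinedIn (S (G x)) (G x) (q (A x)) := fun x hx => by
    rw [hGA _ (hAK x hx) x (hA x hx)]
    exact hS _ (hAK x hx)
  -- The time `3 * l x - 1` is at most 0 for `l x ≤ 1/3` and at least 1 for `l x ≥ 2/3`: the map
  -- rests at `G` near the complement of `O` and at the target near `K`.
  set g : X → Z := fun x => if x ∈ O then P (G x) (q (A x)) (3 * l x - 1) else G x with hg
  have hcont : Continuous g := by
    refine continuous_iff_continuousAt.2 fun x => ?_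
    by_cases hx : x ∈ O
    · have : g =ᶠ[𝓝 x] fun y => P (G x) (q (A x)) (3 * l y - 1) := by
        filter_upwards [Metric.isOpen_ball.mem_nhds (hA x hx)] with y hy
        have hyO : y ∈ O := Set.mem_biUnion (hAK x hx) hy
        simp only [hg, if_pos hyO]
        rw [hqA _ (hAK x hx) y hy, hGA _ (hAK x hx) y hy, hGA _ (hAK x hx) x (hA x hx)]
      refine ContinuousAt.congr ?_ this.symm
      have := hPc (G x) (q (A x))
      fun_prop
    · have hlx : l x = 0 := hl0 hx
      have : g =ᶠ[𝓝 x] G := by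
        have : ∀ᶠ y in 𝓝 x, l y < 1 / 3 :=
          l.continuous.continuousAt.eventually_lt_const (by rw [hlx]; norm_num)
        filter_upwards [this] with y hy
        by_cases hyO : y ∈ O
        · simp only [hg, if_pos hyO]
          exact (hP _ _ (hjoin y hyO)).1 _ (by linarith)
        · simp only [hg, if_neg hyO]
      exact G.continuous.continuousAt.congr this.symm
  refine ⟨⟨g, hcont⟩, fun a ha => ?_, fun x => ?_⟩
  · have hla : l a = 1 := hl1 ha
    have : ∀ᶠ y in 𝓝 a, 2 / 3 < l y :=
      l.continuous.continuousAt.eventually_const_lt (by rw [hla]; norm_num)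
    filter_upwards [this, Metric.ball_mem_nhds a (half_pos (hr0 a ha))] with y hy hya
    have hyO : y ∈ O := Set.mem_biUnion ha hya
    simp only [ContinuousMap.coe_mk, hg, if_pos hyO]
    rw [(hP _ _ (hjoin y hyO)).2.1 _ (by linarith), hqA a ha y hya]
  · by_cases hx : x ∈ O
    · right
      simp only [ContinuousMap.coe_mk, hg, if_pos hx]
      exact (hP _ _ (hjoin x hx)).2.2 _
    · left
      simp only [ContinuousMap.coe_mk, hg, if_neg hx]

/-- A map which is the limit of piecewise locally constant maps, consecutive ones being joined by
small paths, is a pointwise limit of continuous maps. -/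
theorem exists_continuousMap_tendsto_of_joinedIn {X Z : Type*} [TopologicalSpace X]
    [TopologicalSpace.PseudoMetrizableSpace X] [PseudoMetricSpace Z] [PathConnectedSpace Z]
    {h : X → Z} {c : ℕ → X → Z} (hc : ∀ k, PiecewiseLocallyConstant (c k))
    (hj : ∀ k x, JoinedIn (Metric.ball (c k x) (2 * (1 / 2) ^ k)) (c k x) (c (k + 1) x))
    (hlim : ∀ x, Tendsto (fun k => c k x) atTop (𝓝 (h x))) :
    ∃ g : ℕ → C(X, Z), ∀ x, Tendsto (fun n => g n x) atTop (𝓝 (h x)) := by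
  let _ := TopologicalSpace.pseudoMetrizableSpacePseudoMetric X
  choose E h1 h2 h3 h4 using hc
  have hKc : ∀ n k, IsClosed {a | ∀ j ≤ k, a ∈ E j n} := fun n k => by
    have : {a | ∀ j ≤ k, a ∈ E j n} = ⋂ j, ⋂ (_ : j ≤ k), E j n := by ext; simp
    rw [this]
    exact isClosed_iInter fun j => isClosed_iInter fun _ => h2 j n
  have hKl : ∀ n k, ∀ a ∈ {a | ∀ j ≤ k, a ∈ E j n},
      ∀ᶠ b in 𝓝[{a | ∀ j ≤ k, a ∈ E j n}] a, c k b = c k a := fun n k a ha =>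
    nhdsWithin_mono a (fun b (hb : ∀ j ≤ k, b ∈ E j n) => hb k le_rfl) (h4 k n a (ha k le_rfl))
  have main : ∀ n, ∃ G : ℕ → C(X, Z),
      (∀ k, ∀ a ∈ {a | ∀ j ≤ k, a ∈ E j n}, ∀ᶠ b in 𝓝 a, G k b = c k a) ∧
      ∀ k x, dist (G (k + 1) x) (G k x) ≤ 2 * (1 / 2) ^ k := by
    intro n
    obtain ⟨G₀, hG₀, -⟩ := exists_continuousMap_eventually_eq
      (ContinuousMap.const X (Classical.arbitrary Z)) (hKc n 0)
      (fun a _ => by simp) (hKl n 0) (fun _ => Set.univ)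
      (fun a _ => joinedIn_univ.2 (PathConnectedSpace.joined _ _))
    have step : ∀ (k : ℕ) (G : C(X, Z)),
        (∀ a ∈ {a | ∀ j ≤ k, a ∈ E j n}, ∀ᶠ b in 𝓝 a, G b = c k a) → ∃ G' : C(X, Z),
          (∀ a ∈ {a | ∀ j ≤ k + 1, a ∈ E j n}, ∀ᶠ b in 𝓝 a, G' b = c (k + 1) a) ∧
          ∀ x, dist (G' x) (G x) ≤ 2 * (1 / 2) ^ k := by
      intro k G hG
      have hsub : ∀ a ∈ {a | ∀ j ≤ k + 1, a ∈ E j n}, a ∈ {a | ∀ j ≤ k, a ∈ E j n} :=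
        fun a ha j hj => ha j (hj.trans (Nat.le_succ k))
      obtain ⟨G', hG', hd⟩ := exists_continuousMap_eventually_eq G (hKc n (k + 1))
        (fun a ha => (hG a (hsub a ha)).mono fun b hb => by
          rw [hb, (hG a (hsub a ha)).self_of_nhds])
        (hKl n (k + 1)) (fun z => Metric.ball z (2 * (1 / 2) ^ k))
        (fun a ha => by
          rw [(hG a (hsub a ha)).self_of_nhds]
          exact hj k a)
      refine ⟨G', hG', fun x => ?_⟩
      rcases hd x with hx | hx
      · rw [hx, dist_self]
        positivity
      · exact le_of_lt hx
    choose! next hnext hdist using step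
    let G : ℕ → C(X, Z) := fun k => Nat.rec G₀ next k
    have hG : ∀ k, ∀ a ∈ {a | ∀ j ≤ k, a ∈ E j n}, ∀ᶠ b in 𝓝 a, G k b = c k a := by
      intro k
      induction k with
      | zero => exact hG₀
      | succ k ih => exact hnext k (G k) ih
    exact ⟨G, hG, fun k => hdist k (G k) (hG k)⟩
  choose G hG hdist using main
  -- For fixed `k` and large `n`, `G n k x = c k x`; the later moves up to `G n n` total less than
  -- `4 * (1 / 2) ^ k`.
  refine ⟨fun n => G n n, fun x => Metric.tendsto_atTop.2 fun ε hε => ?_⟩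
  have hpow : Tendsto (fun k : ℕ => 4 * (1 / 2 : ℝ) ^ k) atTop (𝓝 0) := by
    simpa using (tendsto_pow_atTop_nhds_zero_of_lt_one (r := (1 / 2 : ℝ))
      (by norm_num) (by norm_num)).const_mul 4
  obtain ⟨k, hk1, hk2⟩ := ((hpow.eventually_lt_const (half_pos hε)).and
    ((hlim x).eventually (Metric.ball_mem_nhds _ (half_pos hε)))).exists
  choose N hN using fun j => h3 j x
  refine ⟨max k ((Finset.range (k + 1)).sup N), fun n hn => ?_⟩
  have hxE : ∀ j ≤ k, x ∈ E j n := fun j hj => h1 j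
    ((Finset.le_sup (f := N) (Finset.mem_range.2 (by omega))).trans
      ((le_max_right _ _).trans hn)) (hN j)
  have hGk : G n k x = c k x := (hG n k x hxE).self_of_nhds
  have hsum : ∀ i, dist (G n (k + i) x) (G n k x) ≤ 4 * (1 / 2) ^ k - 4 * (1 / 2) ^ (k + i) := by
    intro i
    induction i with
    | zero => simp
    | succ i ih =>
      have h5 := dist_triangle (G n (k + i + 1) x) (G n (k + i) x) (G n k x)
      have h6 := hdist n (k + i) x
      rw [← add_assoc, pow_succ _ (k + i)]
      linarith
  obtain ⟨i, rfl⟩ := Nat.exists_eq_add_of_le ((le_max_left _ _).trans hn)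
  have h5 := dist_triangle (G (k + i) (k + i) x) (G (k + i) k x) (h x)
  have h6 := hsum i
  have h7 : dist (c k x) (h x) < ε / 2 := hk2
  have h8 : (0 : ℝ) < (1 / 2) ^ (k + i) := by positivity
  rw [hGk] at h5 h6
  linarith

/-! ### Metrizability of the base and lifting of the limit -/

/-- The weak local homeomorphism inverted over an open cover. -/
theorem IsWeakLocalHomeomorph.exists_sections {Y Z : Type*} [TopologicalSpace Y]
    [TopologicalSpace Z] [Nonempty Z] {φ : Z → Y} (hφ : IsWeakLocalHomeomorph φ) :
    ∃ (V : Y → Set Y) (s : Y → Y → Z), (∀ y, IsOpen (V y)) ∧ (∀ y, y ∈ V y) ∧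
      (∀ i, ContinuousOn (s i) (V i)) ∧ ∀ i, ∀ y ∈ V i, φ (s i y) = y := by
  classical
  have key : ∀ y : Y, ∃ (V : Set Y) (s : Y → Z), IsOpen V ∧ y ∈ V ∧ ContinuousOn s V ∧
      ∀ y ∈ V, φ (s y) = y := by
    intro y
    obtain ⟨V, U, hV, hy, -, e, he⟩ := hφ.2 y
    refine ⟨V, fun y => if h : y ∈ V then (e.symm ⟨y, h⟩ : Z) else Classical.arbitrary Z, hV, hy,
      ?_, fun y hy => ?_⟩
    · rw [continuousOn_iff_continuous_domRestrict]
      have : Continuous fun y : V => (e.symm y : Z) := by fun_prop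
      convert this using 2 with y
      simp
    · simp only [dif_pos hy]
      rw [← he, e.apply_symm_apply]
  choose V s h1 h2 h3 h4 using key
  exact ⟨V, s, h1, h2, h3, h4⟩

/-- A paracompact Hausdorff space weakly covered by a metrizable space is metrizable. -/
theorem IsWeaklyCoveredBy.metrizableSpace {Y Z : Type*} [TopologicalSpace Y] [TopologicalSpace Z]
    [T2Space Y] [ParacompactSpace Y] [TopologicalSpace.PseudoMetrizableSpace Z] [Nonempty Z]
    (h : IsWeaklyCoveredBy Y Z) : TopologicalSpace.MetrizableSpace Y := by
  obtain ⟨φ, hφ⟩ := h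
  obtain ⟨V, s, hV, hmem, hs, hφs⟩ := hφ.exists_sections
  let _ := TopologicalSpace.pseudoMetrizableSpacePseudoMetric Z
  obtain ⟨l, hl⟩ := PartitionOfUnity.exists_isSubordinate isClosed_univ V hV
    (fun y _ => Set.mem_iUnion.2 ⟨y, hmem y⟩)
  -- The coordinate `(i, none)` records the weight `l i`; `(i, some p)` records the weighted,
  -- truncated distance from the section `s i` to `p`. The weight vanishes where `s i` is
  -- uncontrolled.
  let Φ : Y → UniformFun (Y × Option Z) ℝ := fun y => UniformFun.ofFun fun i =>
    l i.1 y * i.2.elim 1 fun p => min 1 (dist (s i.1 y) p)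
  have hΦ : IsInducing Φ := by
    refine isInducing_iff_nhds.2 fun y => le_antisymm ?_ ?_
    · rw [← tendsto_iff_comap]
      refine UniformFun.tendsto_iff_tendstoUniformly.2 ?_
      refine Metric.tendstoUniformly_iff.2 fun ε hε => ?_
      have hfin : ∀ i ∈ l.fintsupport y, ∀ᶠ y' in 𝓝 y,
          dist (l i y') (l i y) < ε / 2 ∧ dist (s i y') (s i y) < ε / 2 := by
        intro i hi
        have hyV : y ∈ V i := hl i ((l.mem_fintsupport_iff y i).1 hi)
        exact ((l i).continuous.continuousAt.eventually
          (Metric.ball_mem_nhds _ (half_pos hε))).and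
          (((hs i).continuousAt ((hV i).mem_nhds hyV)).eventually
            (Metric.ball_mem_nhds _ (half_pos hε)))
      filter_upwards [(Finset.eventually_all _).2 hfin, l.eventually_finsupport_subset y]
        with y' hy' hsub
      rintro ⟨i, o⟩
      by_cases hi : i ∈ l.fintsupport y
      · obtain ⟨h1, h2⟩ := hy' i hi
        set m : Z → ℝ := fun z => o.elim 1 fun p => min 1 (dist z p) with hm
        have hm0 : ∀ z, 0 ≤ m z ∧ m z ≤ 1 := by
          intro z
          cases o with
          | none => simp [hm]
          | some p => simp [hm]
        have hmd : ∀ z w, |m z - m w| ≤ dist z w := by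
          intro z w
          cases o with
          | none => simp [hm]
          | some p =>
            refine (abs_min_sub_min_le_max 1 (dist z p) 1 (dist w p)).trans ?_
            simpa using abs_dist_sub_le z w p
        change |l i y * m (s i y) - l i y' * m (s i y')| < ε
        have h3 : l i y * m (s i y) - l i y' * m (s i y') =
            -((l i y' - l i y) * m (s i y')) - l i y * (m (s i y') - m (s i y)) := by ring
        have h4 : |(l i y' - l i y) * m (s i y')| ≤ |l i y' - l i y| := by
          rw [abs_mul, abs_of_nonneg (hm0 (s i y')).1]
          exact mul_le_of_le_one_right (abs_nonneg _) (hm0 _).2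
        have h5 : |l i y * (m (s i y') - m (s i y))| ≤ dist (s i y') (s i y) := by
          rw [abs_mul, abs_of_nonneg (l.nonneg i y)]
          exact (mul_le_of_le_one_left (abs_nonneg _) (l.le_one i y)).trans (hmd _ _)
        rw [Real.dist_eq] at h1
        rw [h3]
        refine (abs_sub _ _).trans_lt ?_
        rw [abs_neg]
        linarith
      · have h1 : l i y = 0 := by
          by_contra h
          exact hi (l.finsupport_subset_fintsupport y ((l.mem_finsupport y).2 h))
        have h2 : l i y' = 0 := by
          by_contra h
          exact hi (hsub ((l.mem_finsupport y').2 h))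
        change dist (l i y * _) (l i y' * _) < ε
        simpa [h1, h2] using hε
    · intro N hN
      obtain ⟨i, hi⟩ := l.exists_pos (Set.mem_univ y)
      have hyV : ∀ y', 0 < l i y' → y' ∈ V i := fun y' h =>
        hl i (subset_tsupport _ h.ne')
      have hN' : φ ⁻¹' N ∈ 𝓝 (s i y) := hφ.1.continuousAt (by rwa [hφs i y (hyV y hi)])
      obtain ⟨δ, hδ, hball⟩ := Metric.mem_nhds_iff.1 hN'
      have hev : ∀ j, Tendsto (fun u : UniformFun (Y × Option Z) ℝ => UniformFun.toFun u j)
          (𝓝 (Φ y)) (𝓝 (UniformFun.toFun (Φ y) j)) := fun j =>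
        (UniformFun.uniformContinuous_eval ℝ j).continuous.continuousAt
      have h1 : UniformFun.toFun (Φ y) (i, none) = l i y := mul_one _
      have h2 : UniformFun.toFun (Φ y) (i, some (s i y)) = 0 := by
        change l i y * min 1 (dist (s i y) (s i y)) = 0
        simp
      -- The first bound keeps the weight away from zero, so the second forces `s i y'` within `δ`
      -- of `s i y`.
      have e1 := (hev (i, none)).eventually_const_lt (u := l i y / 2) (by rw [h1]; linarith)
      have e2 := (hev (i, some (s i y))).eventually_lt_const (u := l i y / 2 * min 1 δ)
        (by rw [h2]; positivity)
      refine ⟨_, e1.and e2, fun y' hy' => ?_⟩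
      obtain ⟨h3, h4⟩ : l i y / 2 < l i y' * 1 ∧
        l i y' * min 1 (dist (s i y') (s i y)) < l i y / 2 * min 1 δ := hy'
      rw [mul_one] at h3
      have h5 : min 1 (dist (s i y') (s i y)) < min 1 δ := by
        by_contra! h
        have : l i y / 2 * min 1 δ ≤ l i y' * min 1 (dist (s i y') (s i y)) :=
          mul_le_mul h3.le h (by positivity) (by linarith)
        linarith
      have h6 : dist (s i y') (s i y) < δ := by
        rcases min_lt_iff.1 h5 with h | h
        · exact absurd (h.trans_le (min_le_left _ _)) (lt_irrefl _)
        · exact h.trans_le (min_le_right _ _)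
      have h7 : φ (s i y') ∈ N := hball h6
      rwa [hφs i y' (hyV y' (by linarith))] at h7
  have : (uniformity (UniformFun (Y × Option Z) ℝ)).IsCountablyGenerated :=
    (HasCountableBasis.mk (UniformFun.hasBasis_uniformity_of_basis (Y × Option Z) ℝ
      Metric.uniformity_basis_dist_inv_nat_succ) (Set.to_countable _)).isCountablyGenerated
  have := hΦ.pseudoMetrizableSpace
  infer_instance

/-- A pointwise limit of continuous maps into a metric space weakly covered by a locally
path-connected metric space lifts to a uniform limit, along small paths, of piecewise locally
constant maps. -/
theorem IsWeakLocalHomeomorph.exists_lift {X Y Z : Type*} [TopologicalSpace X]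
    [TopologicalSpace.PseudoMetrizableSpace X] [PseudoMetricSpace Y] [PseudoMetricSpace Z]
    [LocallyPathConnectedSpace Z] [Nonempty Z] {φ : Z → Y} (hφ : IsWeakLocalHomeomorph φ)
    {F : ℕ → C(X, Y)} {f : X → Y} (hF : ∀ x, Tendsto (fun n => F n x) atTop (𝓝 (f x))) :
    ∃ h : X → Z, (∀ x, φ (h x) = f x) ∧ ∀ ε > 0, ∃ c : X → Z, PiecewiseLocallyConstant c ∧
      ∀ x, JoinedIn (Metric.ball (c x) ε) (c x) (h x) := by
  obtain ⟨V, s, hV, hmem, hs, hφs⟩ := hφ.exists_sections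
  have happ : ∀ k : ℕ, ∃ a : X → Y, PiecewiseLocallyConstant a ∧
      ∀ x, dist (f x) (a x) < 1 / ((k : ℝ) + 1) := fun k =>
    exists_piecewiseLocallyConstant_dist_lt hF Nat.one_div_pos_of_nat
  choose a ha had using happ
  have hfit : ∀ x, ∀ N ∈ 𝓝 (f x), ∃ k : ℕ, Metric.ball (a k x) (1 / ((k : ℝ) + 1)) ⊆ N := by
    intro x N hN
    obtain ⟨δ, hδ, hball⟩ := Metric.mem_nhds_iff.1 hN
    obtain ⟨k, hk⟩ := exists_nat_one_div_lt (half_pos hδ)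
    refine ⟨k, fun y hy => hball ?_⟩
    have h1 : dist y (a k x) < 1 / ((k : ℝ) + 1) := hy
    have h2 := had k x
    have h3 := dist_triangle_right y (f x) (a k x)
    rw [Metric.mem_ball]
    linarith
  obtain ⟨k, hk, hkc⟩ := PiecewiseLocallyConstant.exists_select ha
    (fun k y => ∃ i, Metric.ball y (1 / ((k : ℝ) + 1)) ⊆ V i)
    (fun x => (hfit x _ ((hV (f x)).mem_nhds (hmem _))).imp fun _ hk => ⟨_, hk⟩)
  have hsel : ∃ I : ℕ × Y → Y, ∀ p : ℕ × Y, (∃ i, Metric.ball p.2 (1 / ((p.1 : ℝ) + 1)) ⊆ V i) →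
      Metric.ball p.2 (1 / ((p.1 : ℝ) + 1)) ⊆ V (I p) := by
    have : Nonempty Y := ⟨φ (Classical.arbitrary Z)⟩
    exact ⟨fun p => Classical.epsilon fun i => Metric.ball p.2 (1 / ((p.1 : ℝ) + 1)) ⊆ V i,
      fun p hp => Classical.epsilon_spec hp⟩
  obtain ⟨I, hI⟩ := hsel
  set i : X → Y := fun x => I (k x, a (k x) x) with hi
  have hic : PiecewiseLocallyConstant i := hkc.map I
  have hiV : ∀ x, f x ∈ V (i x) := fun x => hI (k x, a (k x) x) (hk x) (had _ _)
  refine ⟨fun x => s (i x) (f x), fun x => hφs _ _ (hiV x), fun ε hε => ?_⟩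
  -- A suitable `z` is chosen from `(l, a l x, i x)` alone, not from `f x`, which keeps the choice
  -- piecewise locally constant.
  let R : ℕ → Y × Y → Z → Prop := fun l p z => ∀ y ∈ Metric.ball p.1 (1 / ((l : ℝ) + 1)),
    JoinedIn (Metric.ball z ε) z (s p.2 y)
  obtain ⟨l, hl, hlc⟩ := PiecewiseLocallyConstant.exists_select (c := fun l x => (a l x, i x))
    (fun l => (ha l).prodMk hic) (fun l p => ∃ z, R l p z) (fun x => by
      set z := s (i x) (f x)
      have hz : pathComponentIn (Metric.ball z ε) z ∈ 𝓝 z :=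
        (Metric.isOpen_ball.pathComponentIn z).mem_nhds
          (mem_pathComponentIn_self (Metric.mem_ball_self hε))
      obtain ⟨l, hl⟩ := hfit x _
        (((hs (i x)).continuousAt ((hV _).mem_nhds (hiV x))).preimage_mem_nhds hz)
      exact ⟨l, z, fun y hy => hl hy⟩)
  refine ⟨_, hlc.map fun p => Classical.epsilon (R p.1 p.2), fun x => ?_⟩
  exact Classical.epsilon_spec (hl x) (f x) (had _ _)

theorem exists_continuousMap_tendsto_lift {X Y Z : Type*} [TopologicalSpace X]
    [TopologicalSpace.PseudoMetrizableSpace X] [TopologicalSpace Y]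
    [TopologicalSpace.PseudoMetrizableSpace Y] [TopologicalSpace Z]
    [TopologicalSpace.PseudoMetrizableSpace Z]
    [PathConnectedSpace Z] [LocallyPathConnectedSpace Z] {φ : Z → Y}
    (hφ : IsWeakLocalHomeomorph φ) {F : ℕ → C(X, Y)} {f : X → Y}
    (hF : ∀ x, Tendsto (fun n => F n x) atTop (𝓝 (f x))) :
    ∃ g : ℕ → C(X, Z), ∀ x, Tendsto (fun n => φ (g n x)) atTop (𝓝 (f x)) := by
  let _ := TopologicalSpace.pseudoMetrizableSpacePseudoMetric Y
  let _ := TopologicalSpace.pseudoMetrizableSpacePseudoMetric Z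
  obtain ⟨h, hh, happ⟩ := hφ.exists_lift hF
  choose c hc hcj using fun k : ℕ => happ ((1 / 2) ^ k) (by positivity)
  have hd : ∀ k x, dist (h x) (c k x) < (1 / 2) ^ k := fun k x => (hcj k x).target_mem
  -- Consecutive approximations are joined through `h x`; the radius is `(1/2)^(k+1) + (1/2)^k +
  -- (1/2)^(k+1)`.
  have hj : ∀ k x, JoinedIn (Metric.ball (c k x) (2 * (1 / 2) ^ k)) (c k x) (c (k + 1) x) := by
    intro k x
    have h0 : (0 : ℝ) < (1 / 2) ^ k := by positivity
    refine ((hcj k x).mono (Metric.ball_subset_ball (by linarith))).trans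
      ((hcj (k + 1) x).symm.mono (Metric.ball_subset_ball' ?_))
    have h1 := dist_triangle_left (c (k + 1) x) (c k x) (h x)
    have h2 := hd k x
    have h3 := hd (k + 1) x
    rw [pow_succ] at h3 ⊢
    linarith
  have hlim : ∀ x, Tendsto (fun k => c k x) atTop (𝓝 (h x)) := by
    refine fun x => tendsto_iff_dist_tendsto_zero.2 (squeeze_zero (fun _ => dist_nonneg)
      (fun k => ?_)
      (tendsto_pow_atTop_nhds_zero_of_lt_one (r := (1 / 2 : ℝ)) (by norm_num) (by norm_num)))
    rw [dist_comm]
    exact (hd k x).le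
  obtain ⟨g, hg⟩ := exists_continuousMap_tendsto_of_joinedIn hc hj hlim
  refine ⟨g, fun x => ?_⟩
  rw [← hh x]
  exact (hφ.1.tendsto (h x)).comp (hg x)

/-! ### Arbitrary domains and the main theorem -/

/-- A sequence of continuous maps converging pointwise factors through the metrizable space of
convergent sequences, so its limit is the limit of maps that lift along `φ`. -/
theorem IsWeakLocalHomeomorph.exists_tendsto_of_mem_baireOne {X Y Z : Type*} [TopologicalSpace X]
    [TopologicalSpace Y] [TopologicalSpace.MetrizableSpace Y] [TopologicalSpace Z]
    [TopologicalSpace.PseudoMetrizableSpace Z] [PathConnectedSpace Z]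
    [LocallyPathConnectedSpace Z] {φ : Z → Y} (hφ : IsWeakLocalHomeomorph φ) {f : X → Y}
    (hf : f ∈ baireOne X Y) :
    ∃ g : ℕ → C(X, Z), ∀ x, Tendsto (fun n => φ (g n x)) atTop (𝓝 (f x)) := by
  obtain ⟨F, hF⟩ := hf
  have : TopologicalSpace.PseudoMetrizableSpace (ℕ → Y) := by
    let _ := TopologicalSpace.pseudoMetrizableSpaceUniformity Y
    have := TopologicalSpace.pseudoMetrizableSpaceUniformity_countably_generated Y
    infer_instance
  choose lim hlim using fun w : {u : ℕ → Y | ∃ y, Tendsto u atTop (𝓝 y)} => w.2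
  let j : C(X, {u : ℕ → Y | ∃ y, Tendsto u atTop (𝓝 y)}) := ⟨fun x => ⟨fun n => F n x, f x, hF x⟩, by fun_prop⟩
  let G : ℕ → C({u : ℕ → Y | ∃ y, Tendsto u atTop (𝓝 y)}, Y) := fun n =>
    ⟨fun w => w.1 n, (continuous_apply n).comp continuous_subtype_val⟩
  obtain ⟨g, hg⟩ := exists_continuousMap_tendsto_lift hφ (F := G) hlim
  refine ⟨fun n => (g n).comp j, fun x => ?_⟩
  rw [tendsto_nhds_unique (hF x) (hlim (j x))]
  exact hg (j x)

theorem mainTheorem2 {X Y Z : Type*} [TopologicalSpace X] [TopologicalSpace Y]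
    [TopologicalSpace Z] [T2Space Y] [ParacompactSpace Y] [TopologicalSpace.MetrizableSpace Z]
    [ContractibleSpace Z] [LocallyPathConnectedSpace Z] (hYZ : IsWeaklyCoveredBy Y Z) :
    baireOne X Y = homotopicBaireOne X Y ∧
      ∀ f ∈ baireOne X Y, ∃ F : ℕ → C(X, Y), (∀ n : ℕ, (F n).Nullhomotopic) ∧
        ∀ x : X, Tendsto (fun n => F n x) atTop (𝓝 (f x)) := by
  have := hYZ.metrizableSpace
  obtain ⟨φ, hφ⟩ := hYZ
  obtain ⟨z, hz⟩ := id_nullhomotopic Z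
  -- The constant `φ z` is the same for all `n`, so both claims follow at once.
  have key : ∀ f ∈ baireOne X Y, ∃ F : ℕ → C(X, Y),
      (∀ n : ℕ, (F n).Homotopic (ContinuousMap.const X (φ z))) ∧
        ∀ x : X, Tendsto (fun n => F n x) atTop (𝓝 (f x)) := by
    intro f hf
    obtain ⟨g, hg⟩ := hφ.exists_tendsto_of_mem_baireOne hf
    exact ⟨fun n => (⟨φ, hφ.1⟩ : C(Z, Y)).comp (g n), fun n =>
      (ContinuousMap.Homotopic.refl (⟨φ, hφ.1⟩ : C(Z, Y))).comp
        (hz.comp (ContinuousMap.Homotopic.refl (g n))), hg⟩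
  refine ⟨Set.Subset.antisymm (fun f hf => ?_) fun f hf => ?_, fun f hf => ?_⟩
  · obtain ⟨F, hF, hlim⟩ := key f hf
    exact ⟨F, fun m n => (hF m).trans (hF n).symm, hlim⟩
  · obtain ⟨F, -, hlim⟩ := hf
    exact ⟨F, hlim⟩
  · obtain ⟨F, hF, hlim⟩ := key f hf
    exact ⟨F, fun n => ⟨_, hF n⟩, hlim⟩
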